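/- Let $(M^n,g)$, $n\ge 2$, be a smooth Riemannian manifold (without boundary) with Levi-Civita connection $\nabla$, Ricci tensor $\mathrm{Ric}$ and scalar curvature $R$, and let $(M^n,g,X,\rho)$ be an almost Yamabe soliton, i.e. $X$ is a smooth vector field and $\rho$ a smooth function on $M$ with $$\tfrac12\,\mathcal L_X g=(R-\rho)\,g .$$ Put $\psi=R-\rho$, and assume that $X$ is closed, i.e. $\nabla_YX=\psi\,Y$ for every vector field $Y$. Then either (i) $X$ is a Killing vector field, i.e. $\mathcal L_Xg=0$ on $M$, or (ii) at every point where $X\neq 0$, $$\Big[Dd\psi+\frac{R\psi}{n-1}\,g-\psi\,\mathrm{Ric}\Big]\Big(\frac{X}{|X|},\frac{X}{|X|}\Big)=\Delta\psi+\frac{R\psi}{n-1},$$ where $Dd\psi$ is the Hessian of $\psi$, i.e. $Dd\psi(Y,Z)=g(\nabla_Y\nabla\psi,Z)$, and $\Delta\psi$ is its trace with respect to $g$. -/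

import Mathlib

open Bundle Manifold VectorField FiberBundle
open scoped ContDiff

set_option linter.unusedSectionVars false

namespace Riem

noncomputable section

variable {E : Type*} [NormedAddCommGroup E] [NormedSpace ℝ E] [FiniteDimensional ℝ E]
  {H : Type*} [TopologicalSpace H] {I : ModelWithCorners ℝ E H}
  {M : Type*} [TopologicalSpace M] [ChartedSpace H M] [IsManifold I ∞ M]
  [RiemannianBundle (fun x : M => TangentSpace I x)]
  [IsContMDiffRiemannianBundle I ∞ E (fun x : M => TangentSpace I x)]

instance finiteDimensionalTangentSpace (p : M) : FiniteDimensional ℝ (TangentSpace I p) :=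
  VectorBundle.finiteDimensional ℝ E (fun x : M => TangentSpace I x) p

instance completeTangentSpace (p : M) : CompleteSpace (TangentSpace I p) :=
  FiniteDimensional.complete ℝ (TangentSpace I p)

/-- The musical isomorphism `♯ : T*_p M → T_p M`, defined by `⟨φ♯, w⟩ = φ w`. -/
def sharp (p : M) : (TangentSpace I p →L[ℝ] ℝ) →L[ℝ] TangentSpace I p :=
  LinearMap.toContinuousLinearMap
    { toFun := fun φ => (InnerProductSpace.toDual ℝ (TangentSpace I p)).symm φ
      map_add' := fun φ φ' => by simp
      map_smul' := fun c φ => by simp }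

theorem inner_sharp (p : M) (φ : TangentSpace I p →L[ℝ] ℝ) (w : TangentSpace I p) :
    inner ℝ (sharp p φ) w = φ w :=
  InnerProductSpace.toDual_symm_apply

theorem mdifferentiableAt_inner {X Y : Π x : M, TangentSpace I x} {p : M}
    (hX : MDiffAt (T% X) p) (hY : MDiffAt (T% Y) p) :
    MDiffAt (fun q => inner ℝ (X q) (Y q)) p :=
  MDifferentiableAt.inner_bundle (E := fun x : M => TangentSpace I x) hX hY

/-! ### The Levi-Civita connection -/

/-- The right-hand side of the Koszul formula: for differentiable vector fields this is
`2⟨∇_Y X, Z⟩` at `p`. -/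
def koszul (X Y Z : Π x : M, TangentSpace I x) (p : M) : ℝ :=
  d% (fun q => inner ℝ (X q) (Z q)) p (Y p) + d% (fun q => inner ℝ (Y q) (Z q)) p (X p)
    - d% (fun q => inner ℝ (Y q) (X q)) p (Z p)
    + inner ℝ (mlieBracket I Y X p) (Z p) - inner ℝ (mlieBracket I Y Z p) (X p)
    - inner ℝ (mlieBracket I X Z p) (Y p)

theorem koszul_tensorial_Y {X Z : Π x : M, TangentSpace I x} {p : M}
    (hX : MDiffAt (T% X) p) (hZ : MDiffAt (T% Z) p) :
    TensorialAt I E (fun Y => koszul X Y Z p) p where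
  smul {f Y} hf hY := by
    have h1 : (fun q => inner ℝ ((f • Y) q) (Z q)) = f * fun q => inner ℝ (Y q) (Z q) := by
      ext q; simp [inner_smul_left]
    have h2 : (fun q => inner ℝ ((f • Y) q) (X q)) = f * fun q => inner ℝ (Y q) (X q) := by
      ext q; simp [inner_smul_left]
    simp only [koszul, h1, h2, mvfderiv_mul hf (mdifferentiableAt_inner hY hZ),
      mvfderiv_mul hf (mdifferentiableAt_inner hY hX), mlieBracket_smul_left hf hY]
    simp [inner_add_left, inner_smul_left, inner_smul_right]
    ring
  add {Y Y'} hY hY' := by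
    have h1 : (fun q => inner ℝ ((Y + Y') q) (Z q)) =
        (fun q => inner ℝ (Y q) (Z q)) + fun q => inner ℝ (Y' q) (Z q) := by
      ext q; simp [inner_add_left]
    have h2 : (fun q => inner ℝ ((Y + Y') q) (X q)) =
        (fun q => inner ℝ (Y q) (X q)) + fun q => inner ℝ (Y' q) (X q) := by
      ext q; simp [inner_add_left]
    simp only [koszul, h1, h2, mvfderiv_add (mdifferentiableAt_inner hY hZ) (mdifferentiableAt_inner hY' hZ),
      mvfderiv_add (mdifferentiableAt_inner hY hX) (mdifferentiableAt_inner hY' hX), mlieBracket_add_left hY hY']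
    simp [inner_add_left, inner_add_right]
    ring

theorem koszul_tensorial_Z {X Y : Π x : M, TangentSpace I x} {p : M}
    (hX : MDiffAt (T% X) p) (hY : MDiffAt (T% Y) p) :
    TensorialAt I E (fun Z => koszul X Y Z p) p where
  smul {f Z} hf hZ := by
    have h1 : (fun q => inner ℝ (Y q) ((f • Z) q)) = f * fun q => inner ℝ (Y q) (Z q) := by
      ext q; simp [inner_smul_right]
    have h2 : (fun q => inner ℝ (X q) ((f • Z) q)) = f * fun q => inner ℝ (X q) (Z q) := by
      ext q; simp [inner_smul_right]
    simp only [koszul, h1, h2, mvfderiv_mul hf (mdifferentiableAt_inner hY hZ),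
      mvfderiv_mul hf (mdifferentiableAt_inner hX hZ), mlieBracket_smul_right hf hZ]
    simp [inner_add_left, inner_smul_left, inner_smul_right]
    rw [real_inner_comm (Z p) (X p), real_inner_comm (Z p) (Y p)]
    ring
  add {Z Z'} hZ hZ' := by
    have h1 : (fun q => inner ℝ (Y q) ((Z + Z') q)) =
        (fun q => inner ℝ (Y q) (Z q)) + fun q => inner ℝ (Y q) (Z' q) := by
      ext q; simp [inner_add_right]
    have h2 : (fun q => inner ℝ (X q) ((Z + Z') q)) =
        (fun q => inner ℝ (X q) (Z q)) + fun q => inner ℝ (X q) (Z' q) := by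
      ext q; simp [inner_add_right]
    simp only [koszul, h1, h2, mvfderiv_add (mdifferentiableAt_inner hY hZ) (mdifferentiableAt_inner hY hZ'),
      mvfderiv_add (mdifferentiableAt_inner hX hZ) (mdifferentiableAt_inner hX hZ'), mlieBracket_add_right hZ hZ']
    simp [inner_add_left, inner_add_right]
    ring

open Classical in
/-- `nabla X p v = ∇_v X`, the vector determined by the Koszul formula (and the junk value `0`
if `X` is not differentiable at `p`). -/
def nabla (X : Π x : M, TangentSpace I x) (p : M) : TangentSpace I p →L[ℝ] TangentSpace I p :=
  if hX : MDiffAt (T% X) p then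
    (1 / 2 : ℝ) • sharp p ∘L TensorialAt.mkHom₂ (fun Y Z => koszul X Y Z p) p
      (fun _ hZ => koszul_tensorial_Y hX hZ) (fun _ hY => koszul_tensorial_Z hX hY)
  else 0

theorem two_inner_nabla {X Y Z : Π x : M, TangentSpace I x} {p : M}
    (hX : MDiffAt (T% X) p) (hY : MDiffAt (T% Y) p) (hZ : MDiffAt (T% Z) p) :
    2 * inner ℝ (nabla X p (Y p)) (Z p) = koszul X Y Z p := by
  have := TensorialAt.mkHom₂_apply (Φ := fun Y Z => koszul X Y Z p)
    (fun _ hZ => koszul_tensorial_Y hX hZ) (fun _ hY => koszul_tensorial_Z hX hY) hY hZ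
  simp only [nabla, dif_pos hX, smul_apply,
    ContinuousLinearMap.comp_apply, inner_smul_left, inner_sharp, this]
  simp

theorem exists_extension {p : M} (v : TangentSpace I p) :
    ∃ V : Π x : M, TangentSpace I x, MDiffAt (T% V) p ∧ V p = v :=
  ⟨extend E v, mdifferentiableAt_extend I E v, by simp⟩

theorem nabla_add {X X' : Π x : M, TangentSpace I x} {p : M}
    (hX : MDiffAt (T% X) p) (hX' : MDiffAt (T% X') p) :
    nabla (X + X') p = nabla X p + nabla X' p := by
  ext v
  refine ext_inner_right ℝ fun w => ?_
  obtain ⟨Y, hv, rfl⟩ := exists_extension v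
  obtain ⟨Z, hw, rfl⟩ := exists_extension w
  have h1 : (fun q => inner ℝ ((X + X') q) (Z q)) =
      (fun q => inner ℝ (X q) (Z q)) + fun q => inner ℝ (X' q) (Z q) := by
    ext q; simp [inner_add_left]
  have h2 : (fun q => inner ℝ (Y q) ((X + X') q)) =
      (fun q => inner ℝ (Y q) (X q)) + fun q => inner ℝ (Y q) (X' q) := by
    ext q; simp [inner_add_right]
  have e0 := two_inner_nabla (mdifferentiableAt_add_section hX hX') hv hw
  have e1 := two_inner_nabla hX hv hw
  have e2 := two_inner_nabla hX' hv hw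
  simp only [koszul, h1, h2, mvfderiv_add (mdifferentiableAt_inner hX hw)
    (mdifferentiableAt_inner hX' hw), mvfderiv_add (mdifferentiableAt_inner hv hX)
    (mdifferentiableAt_inner hv hX'), mlieBracket_add_left hX hX',
    mlieBracket_add_right hX hX'] at e0 e1 e2
  simp only [Pi.add_apply, inner_add_left, inner_add_right, add_apply, map_add] at e0 ⊢
  linarith

theorem nabla_smul {X : Π x : M, TangentSpace I x} {f : M → ℝ} {p : M}
    (hX : MDiffAt (T% X) p) (hf : MDiffAt f p) :
    nabla (f • X) p = f p • nabla X p + (d% f p).smulRight (X p) := by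
  ext v
  refine ext_inner_right ℝ fun w => ?_
  obtain ⟨Y, hv, rfl⟩ := exists_extension v
  obtain ⟨Z, hw, rfl⟩ := exists_extension w
  have h1 : (fun q => inner ℝ ((f • X) q) (Z q)) = f * fun q => inner ℝ (X q) (Z q) := by
    ext q; simp [inner_smul_left]
  have h2 : (fun q => inner ℝ (Y q) ((f • X) q)) = f * fun q => inner ℝ (Y q) (X q) := by
    ext q; simp [inner_smul_right]
  have e0 := two_inner_nabla (hf.smul_section hX) hv hw
  have e1 := two_inner_nabla hX hv hw
  simp only [koszul, h1, h2, mvfderiv_mul hf (mdifferentiableAt_inner hX hw),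
    mvfderiv_mul hf (mdifferentiableAt_inner hv hX), mlieBracket_smul_left hf hX,
    mlieBracket_smul_right hf hX] at e0 e1
  simp [inner_add_left, inner_smul_left, inner_smul_right] at e0 ⊢
  rw [real_inner_comm (Y p) (X p)] at e0
  linear_combination (1 / 2) * e0 - (f p / 2) * e1

/-- The Levi-Civita connection of the Riemannian metric. -/
def leviCivita : CovariantDerivative I E (fun x : M => TangentSpace I x) where
  toFun := nabla
  isCovariantDerivativeOnUniv :=
    { add := fun hX hX' _ => nabla_add hX hX'
      leibniz := fun hX hf _ => nabla_smul hX hf }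

/-- The Levi-Civita connection is torsion free. -/
theorem leviCivita_torsion {X Y : Π x : M, TangentSpace I x} {p : M}
    (hX : MDiffAt (T% X) p) (hY : MDiffAt (T% Y) p) :
    leviCivita Y p (X p) - leviCivita X p (Y p) = mlieBracket I X Y p := by
  refine ext_inner_right ℝ fun w => ?_
  obtain ⟨Z, hw, rfl⟩ := exists_extension w
  have e1 := two_inner_nabla hX hY hw
  have e2 := two_inner_nabla hY hX hw
  have c : (fun q => inner ℝ (Y q) (X q)) = fun q => inner ℝ (X q) (Y q) := by
    ext q; exact real_inner_comm _ _
  have s : mlieBracket I Y X p = - mlieBracket I X Y p := mlieBracket_swap_apply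
  simp only [koszul, c, s, inner_neg_left] at e1 e2
  simp only [leviCivita, inner_sub_left]
  linarith

/-- The Levi-Civita connection is compatible with the metric. -/
theorem leviCivita_metric {X Y Z : Π x : M, TangentSpace I x} {p : M}
    (hX : MDiffAt (T% X) p) (hY : MDiffAt (T% Y) p) (hZ : MDiffAt (T% Z) p) :
    d% (fun q => inner ℝ (Y q) (Z q)) p (X p) =
      inner ℝ (leviCivita Y p (X p)) (Z p) + inner ℝ (Y p) (leviCivita Z p (X p)) := by
  have e1 := two_inner_nabla hY hX hZ
  have e2 := two_inner_nabla hZ hX hY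
  have c : (fun q => inner ℝ (Z q) (Y q)) = fun q => inner ℝ (Y q) (Z q) := by
    ext q; exact real_inner_comm _ _
  have s : mlieBracket I Z Y p = - mlieBracket I Y Z p := mlieBracket_swap_apply
  simp only [koszul, c, s, inner_neg_left] at e1 e2
  simp only [leviCivita]
  rw [real_inner_comm _ (Y p)]
  linarith

/-! ### Curvature -/

/-- `Rm(U, V)W = ∇_U ∇_V W - ∇_V ∇_U W - ∇_[U,V] W` at `p`, for vector fields. -/
def curvatureField (U V W : Π x : M, TangentSpace I x) (p : M) : TangentSpace I p :=
  leviCivita (fun q => leviCivita W q (V q)) p (U p)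
    - leviCivita (fun q => leviCivita W q (U q)) p (V p)
    - leviCivita W p (mlieBracket I U V p)

/-- The Riemann curvature `Rm(u, v)w` of tangent vectors at `p`: the value of `curvatureField` on
vector fields that are smooth near `p` and extend `u`, `v`, `w`. -/
def curvature (p : M) (u v w : TangentSpace I p) : TangentSpace I p :=
  curvatureField (I := I) (extend E u) (extend E v) (extend E w) p

/-- The Ricci curvature `Ric(v, w) = ∑ᵢ ⟨Rm(eᵢ, v)w, eᵢ⟩`, for `(eᵢ)` an orthonormal basis
of `T_p M`. -/
def ricci (p : M) (v w : TangentSpace I p) : ℝ :=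
  ∑ i, inner ℝ (curvature p (stdOrthonormalBasis ℝ (TangentSpace I p) i) v w)
    (stdOrthonormalBasis ℝ (TangentSpace I p) i)

variable (I) in
/-- The scalar curvature, the metric trace of the Ricci curvature. -/
def scalarCurvature (p : M) : ℝ :=
  ∑ i, ricci p (stdOrthonormalBasis ℝ (TangentSpace I p) i)
    (stdOrthonormalBasis ℝ (TangentSpace I p) i)

/-! ### Gradient, Hessian, Laplacian -/

variable (I) in
/-- The gradient: `⟨∇f, w⟩ = df(w)`. -/
def grad (f : M → ℝ) (p : M) : TangentSpace I p := sharp p (d% f p)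

/-- The Hessian `Ddf(v, w) = ⟨∇_v ∇f, w⟩`. -/
def hessian (f : M → ℝ) (p : M) (v w : TangentSpace I p) : ℝ :=
  inner ℝ (leviCivita (grad I f) p v) w

variable (I) in
/-- The Laplacian, the metric trace of the Hessian. -/
def laplacian (f : M → ℝ) (p : M) : ℝ :=
  ∑ i, hessian f p (stdOrthonormalBasis ℝ (TangentSpace I p) i)
    (stdOrthonormalBasis ℝ (TangentSpace I p) i)

/-! ### Almost Yamabe solitons -/

/-- The Lie derivative of the metric,
`(L_X g)(Y, Z) = X(g(Y, Z)) - g([X, Y], Z) - g(Y, [X, Z])` at `p`, for vector fields `Y`, `Z`. -/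
def lieMetricField (X Y Z : Π x : M, TangentSpace I x) (p : M) : ℝ :=
  d% (fun q => inner ℝ (Y q) (Z q)) p (X p) - inner ℝ (mlieBracket I X Y p) (Z p)
    - inner ℝ (Y p) (mlieBracket I X Z p)

/-- The Lie derivative `(L_X g)(v, w)` of the metric on tangent vectors at `p`: the value of
`lieMetricField` on vector fields that are smooth near `p` and extend `v`, `w`. -/
def lieMetric (X : Π x : M, TangentSpace I x) (p : M) (v w : TangentSpace I p) : ℝ :=
  lieMetricField X (extend E v) (extend E w) p

/-- `X` is a Killing vector field: `L_X g = 0`. -/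
def IsKilling (X : Π x : M, TangentSpace I x) : Prop :=
  ∀ (p : M) (v w : TangentSpace I p), lieMetric X p v w = 0

variable (I) in
/-- The conformal factor `ψ = R - ρ`. -/
def conformalFactor (ρ : M → ℝ) (p : M) : ℝ := scalarCurvature I p - ρ p

/-- `(M, g, X, ρ)` is an almost Yamabe soliton: `X` and `ρ` are smooth and
`(1/2) L_X g = (R - ρ) g`. -/
structure IsAlmostYamabeSoliton (X : Π x : M, TangentSpace I x) (ρ : M → ℝ) : Prop where
  smooth_field : CMDiff ∞ (T% X)
  smooth_fun : CMDiff ∞ ρ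
  lie_eq : ∀ (p : M) (v w : TangentSpace I p),
    (1 / 2) * lieMetric X p v w = conformalFactor I ρ p * inner ℝ v w

/-- The vector field `X` of an almost Yamabe soliton is closed: `∇_Y X = ψ Y` for all `Y`,
where `ψ = R - ρ`. -/
def IsClosedField (X : Π x : M, TangentSpace I x) (ρ : M → ℝ) : Prop :=
  ∀ (p : M) (v : TangentSpace I p), leviCivita X p v = conformalFactor I ρ p • v

end

end Riem

namespace Riem

open scoped Topology

noncomputable section

variable {E : Type*} [NormedAddCommGroup E] [NormedSpace ℝ E] [FiniteDimensional ℝ E]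
  {H : Type*} [TopologicalSpace H] {I : ModelWithCorners ℝ E H}
  {M : Type*} [TopologicalSpace M] [ChartedSpace H M] [IsManifold I ∞ M]

/-! ### Directional derivatives and brackets of smooth vector fields -/

/-! Alternative (ii) holds for every closed field, so Killing fields need no separate treatment.
Differentiating `∇X = ψ·id` once more gives `Rm(U, V)X = dψ(U) V - dψ(V) U`
(`curvatureField_of_closed`). Pairing with `X` and using that `Rm(U, V)` is skew-adjoint shows that,
where `X ≠ 0`, `∇ψ = φX` with `φ = dψ(X)/|X|²`. Differentiating this gives `Ddψ = φψ g + dφ ⊗ ⟨X,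
·⟩`, hence `Δψ = nφψ + dφ(X)`; tracing the curvature formula gives `Ric(·, X) = (1 - n) dψ`. For `e
= X/|X|` this reads `Ddψ(e, e) = φψ + dφ(X)` and `Ric(e, e) = (1 - n)φ`, so `Ddψ(e, e) - ψ Ric(e, e)
= Δψ`, and the scalar curvature terms agree because `|e| = 1`.

Skew-adjointness (`inner_curvatureField_swap`) is the commutator identity for `[U, V]` applied to
`⟨W, Z⟩`. It requires `∇_V W` to be differentiable, which is extracted from the Koszul formula.
Regularity of `ψ` comes from `X` itself, not from the scalar curvature. -/

theorem mvfderiv_congr {f g : M → ℝ} {p : M} (h : f =ᶠ[𝓝 p] g) :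
    d% f p = d% g p := by
  ext v
  exact congrArg (fun A : E →L[ℝ] ℝ => A v) h.mfderiv_eq

/-- The derivative of a function of class `C^n` along a vector field of class `C^m` is of class
`C^m` if `m + 1 ≤ n`. -/
theorem contMDiffAt_mvfderiv_apply {m n : ℕ∞ω} {f : M → ℝ} {X : Π x : M, TangentSpace I x} {p : M}
    [IsManifold I n M]
    (hf : CMDiffAt n f p) (hX : CMDiffAt m (T% X) p) (hmn : m + 1 ≤ n) :
    CMDiffAt m (fun q => d% f q (X q)) p := by
  have := ContMDiffAt.clm_apply_of_inCoordinates (b₁ := id) (b₂ := f) (v := X)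
    (ϕ := fun q => mfderiv% f q) (hf.mfderiv_const hmn) hX (hf.of_le (le_self_add.trans hmn))
  rw [contMDiffAt_totalSpace] at this
  simp at this
  exact this.2

theorem eventuallyEq_mlieBracket_smul_right {V W : Π x : M, TangentSpace I x} {f : M → ℝ} {p : M}
    (hf : CMDiffAt 2 f p) (hW : CMDiffAt 2 (T% W) p) :
    mlieBracket I V (f • W) =ᶠ[𝓝 p]
      ((fun q => d% f q (V q)) • W + f • mlieBracket I V W : Π x : M, TangentSpace I x) := by
  filter_upwards [(contMDiffAt_iff_contMDiffAt_nhds (by simp)).1 hf,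
    (contMDiffAt_iff_contMDiffAt_nhds (by simp)).1 hW] with q hfq hWq
  exact mlieBracket_smul_right (hfq.mdifferentiableAt two_ne_zero)
    (hWq.mdifferentiableAt two_ne_zero)

theorem contMDiffAt_mlieBracket {U V : Π x : M, TangentSpace I x} {p : M}
    (hU : CMDiffAt 2 (T% U) p) (hV : CMDiffAt 2 (T% V) p) :
    CMDiffAt 1 (T% (mlieBracket I U V)) p := by
  have : IsManifold I (((2 : ℕ∞) : ℕ∞ω) + 1) M :=
    .of_le (n := ∞) (by exact_mod_cast le_top (a := (3 : ℕ∞)))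
  have : IsManifold I (minSmoothness ℝ 2) M := by
    rw [minSmoothness_of_isRCLikeNormedField]; infer_instance
  exact ContMDiffAt.mlieBracket_vectorField (n := 2) (m := 1) hU hV
    (by simp; exact_mod_cast (by norm_num : (1 : ℕ∞) + 1 ≤ 2))

/-- Two applications of the Leibniz rule. The middle terms are symmetric in `U` and `V`, so they
cancel in the Jacobi identity for `U`, `V`, `fW`. -/
theorem mlieBracket_mlieBracket_smul {U V W : Π x : M, TangentSpace I x} {f : M → ℝ} {p : M}
    (hV : CMDiffAt 2 (T% V) p) (hW : CMDiffAt 2 (T% W) p) (hf : CMDiffAt 2 f p) :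
    mlieBracket I U (mlieBracket I V (f • W)) p =
      d% (fun q => d% f q (V q)) p (U p) • W p + d% f p (V p) • mlieBracket I U W p
        + (d% f p (U p) • mlieBracket I V W p + f p • mlieBracket I U (mlieBracket I V W) p) := by
  have hV1 : CMDiffAt 1 (T% V) p := hV.of_le one_le_two
  have hW1 := hW.mdifferentiableAt two_ne_zero
  have hf1 := hf.mdifferentiableAt two_ne_zero
  have hb := (contMDiffAt_mlieBracket hV hW).mdifferentiableAt one_ne_zero
  have hd : MDiffAt (fun q => d% f q (V q)) p :=
    (contMDiffAt_mvfderiv_apply hf hV1 (by norm_num [one_add_one_eq_two])).mdifferentiableAt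
      one_ne_zero
  rw [Filter.EventuallyEq.mlieBracket_vectorField_eq (Filter.EventuallyEq.refl _ U)
    (eventuallyEq_mlieBracket_smul_right hf hW),
    mlieBracket_add_right (hd.smul_section hW1) (hf1.smul_section hb),
    mlieBracket_smul_right hd hW1, mlieBracket_smul_right hf1 hb]

/-- The bracket of vector fields is the commutator of the corresponding derivations. -/
theorem mvfderiv_mlieBracket {U V : Π x : M, TangentSpace I x} {f : M → ℝ} {p : M}
    (hU : CMDiffAt 2 (T% U) p) (hV : CMDiffAt 2 (T% V) p) (hf : CMDiffAt 2 f p) :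
    d% (fun q => d% f q (V q)) p (U p) - d% (fun q => d% f q (U q)) p (V p) =
      d% f p (mlieBracket I U V p) := by
  rcases subsingleton_or_nontrivial (TangentSpace I p) with hs | hs
  · simp [Subsingleton.elim (U p) 0, Subsingleton.elim (V p) 0,
      Subsingleton.elim (mlieBracket I U V p) 0]
  obtain ⟨w, hw⟩ := exists_ne (0 : TangentSpace I p)
  have : IsManifold I (minSmoothness ℝ 3) M := by
    rw [minSmoothness_of_isRCLikeNormedField]; infer_instance
  let W : Π x : M, TangentSpace I x := extend E w
  have hW : CMDiffAt 2 (T% W) p := contMDiffAt_extend I E w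
  have hWp : W p = w := extend_apply_self E w
  have h2 : minSmoothness ℝ 2 ≤ 2 := minSmoothness_of_isRCLikeNormedField.le
  -- The Jacobi identity for `fW` minus `f` times the one for `W` leaves the commutator identity
  -- multiplied by `W p = w`, and `w ≠ 0` can be cancelled.
  have key := leibniz_identity_mlieBracket_apply (W := f • W) (hU.of_le h2) (hV.of_le h2)
    ((hf.smul_section hW).of_le h2)
  have key' := leibniz_identity_mlieBracket_apply (hU.of_le h2) (hV.of_le h2) (hW.of_le h2)
  rw [mlieBracket_mlieBracket_smul hV hW hf, mlieBracket_mlieBracket_smul hU hW hf,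
    mlieBracket_smul_right (hf.mdifferentiableAt two_ne_zero) (hW.mdifferentiableAt two_ne_zero),
    key', hWp] at key
  refine smul_left_injective ℝ hw ?_
  simp only [sub_smul]
  rw [← sub_eq_zero] at key ⊢
  rw [← key]
  module

variable [RiemannianBundle (fun x : M => TangentSpace I x)]
  [IsContMDiffRiemannianBundle I ∞ E (fun x : M => TangentSpace I x)]

/-! ### Regularity of the Levi-Civita connection -/

theorem contMDiffAt_inner {n : ℕ∞ω} [IsContMDiffRiemannianBundle I n E
    (fun x : M => TangentSpace I x)] {X Y : Π x : M, TangentSpace I x} {p : M}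
    (hX : CMDiffAt n (T% X) p) (hY : CMDiffAt n (T% Y) p) :
    CMDiffAt n (fun q => inner ℝ (X q) (Y q)) p :=
  ContMDiffAt.inner_bundle (E := fun x : M => TangentSpace I x) hX hY

theorem mdifferentiableAt_fun_sum {ι : Type} {F : Type*} [NormedAddCommGroup F] [NormedSpace ℝ F]
    {s : Finset ι} {f : ι → M → F} {p : M} (hf : ∀ i ∈ s, MDiffAt (f i) p) :
    MDiffAt (fun q => ∑ i ∈ s, f i q) p := by
  have := MDifferentiableAt.sum hf
  rwa [Finset.sum_fn] at this

/-- A vector field is differentiable if all its inner products with smooth fields are. -/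
theorem mdifferentiableAt_of_inner {S : Π x : M, TangentSpace I x} {p : M}
    (hS : ∀ Z : Π x : M, TangentSpace I x, CMDiffAt 2 (T% Z) p →
      MDiffAt (fun q => inner ℝ (S q) (Z q)) p) :
    MDiffAt (T% S) p := by
  let t := trivializationAt E (TangentSpace I : M → Type _) p
  let b := Module.finBasis ℝ E
  let Z : Fin (Module.finrank ℝ E) → Π x : M, TangentSpace I x := fun i q => t.symm q (b i)
  have hp : p ∈ t.baseSet := FiberBundle.mem_baseSet_trivializationAt' p
  have hZ : ∀ i, CMDiffAt 2 (T% (Z i)) p := fun i => by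
    rw [contMDiffAt_section]
    refine (contMDiffAt_const (c := b i)).congr_of_eventuallyEq ?_
    filter_upwards [t.open_baseSet.mem_nhds hp] with q hq
    exact congrArg Prod.snd (t.apply_mk_symm hq (b i))
  -- `G` is the Gram operator of the local frame `Z`. It sends the coordinates of `S` to the vector
  -- `c` of inner products `⟨S, Z j⟩`, so those coordinates are recovered as `G⁻¹ c`.
  let G : M → E →L[ℝ] E := fun q => ∑ i, ∑ j, inner ℝ (Z i q) (Z j q) •
    (LinearMap.toContinuousLinearMap (b.coord i)).smulRight (b j)
  let c : M → E := fun q => ∑ j, inner ℝ (S q) (Z j q) • b j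
  have hG : MDiffAt G p := by
    refine mdifferentiableAt_fun_sum fun i _ => mdifferentiableAt_fun_sum fun j _ => ?_
    exact (mdifferentiableAt_inner ((hZ i).mdifferentiableAt two_ne_zero)
      ((hZ j).mdifferentiableAt two_ne_zero)).smul mdifferentiableAt_const
  have hc : MDiffAt c p :=
    mdifferentiableAt_fun_sum fun j _ => (hS _ (hZ j)).smul mdifferentiableAt_const
  have symm_eq : ∀ q ∈ t.baseSet, ∀ v : E, ∑ i, b.coord i v • Z i q = t.symm q v := fun q hq v => by
    have := congrArg (t.symmₗ ℝ q) (b.sum_repr v)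
    rw [map_sum] at this
    simp only [map_smul] at this
    simp only [t.symmₗ_apply hq] at this
    exact this
  have G_apply : ∀ q ∈ t.baseSet, ∀ v : E,
      G q v = ∑ j, inner ℝ (t.symm q v) (Z j q) • b j := fun q hq v => by
    rw [← symm_eq q hq]
    simp only [G, _root_.sum_apply, _root_.smul_apply,
      ContinuousLinearMap.smulRight_apply, sum_inner, inner_smul_left, Finset.sum_smul, smul_smul]
    rw [Finset.sum_comm]
    simp [mul_comm]
  -- A vector orthogonal to the whole frame is orthogonal to itself.
  have G_inj : Function.Injective (G p) := by
    rw [injective_iff_map_eq_zero]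
    intro v hv
    rw [G_apply p hp] at hv
    have h0 : ∀ j, inner ℝ (t.symm p v) (Z j p) = 0 := fun j =>
      Fintype.linearIndependent_iff.1 b.linearIndependent _ hv j
    have h1 : inner ℝ (t.symm p v) (t.symm p v) = 0 := by
      nth_rw 2 [← symm_eq p hp]
      simp [inner_sum, inner_smul_right, h0]
    rw [inner_self_eq_zero] at h1
    have := congrArg Prod.snd (t.apply_mk_symm hp v)
    rw [h1] at this
    exact this.symm.trans (t.linear ℝ hp).map_zero
  let e : E ≃L[ℝ] E := (LinearEquiv.ofInjectiveEndo (G p : E →ₗ[ℝ] E) G_inj).toContinuousLinearEquiv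
  have he : (e : E →L[ℝ] E) = G p := by ext v; rfl
  have hinv : MDiffAt (fun q => (G q).inverse) p := by
    have := (contDiffAt_map_inverse (n := 1) e).differentiableAt one_ne_zero
    rw [he] at this
    exact this.comp_mdifferentiableAt hG
  rw [mdifferentiableAt_section]
  refine (hinv.clm_apply hc).congr_of_eventuallyEq ?_
  -- Invertibility is an open condition, so near `p` the value `inverse` is a genuine inverse and
  -- not the default `0`.
  have hunit : ∀ᶠ q in 𝓝 p, (G q) ∈ Set.range ((↑) : (E ≃L[ℝ] E) → E →L[ℝ] E) :=
    hG.continuousAt.eventually_mem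
      (by rw [← he]; exact ContinuousLinearEquiv.nhds e)
  filter_upwards [t.open_baseSet.mem_nhds hp, hunit] with q hq ⟨e', he'⟩
  have hcq : c q = G q (t ⟨q, S q⟩).2 := by
    rw [G_apply q hq, t.symm_apply_apply_mk hq]
  rw [hcq, ← he', ContinuousLinearMap.inverse_equiv]
  exact (e'.symm_apply_apply _).symm

/-- The covariant derivative of a vector field of class `C^2` along another is differentiable. -/
theorem mdifferentiableAt_leviCivita {V W : Π x : M, TangentSpace I x} {p : M}
    (hV : CMDiffAt 2 (T% V) p) (hW : CMDiffAt 2 (T% W) p) :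
    MDiffAt (T% (fun q => leviCivita W q (V q))) p := by
  have diff_d : ∀ {A B C : Π x : M, TangentSpace I x}, CMDiffAt 2 (T% A) p → CMDiffAt 2 (T% B) p →
      CMDiffAt 2 (T% C) p → MDiffAt (fun q => d% (fun r => inner ℝ (A r) (B r)) q (C q)) p :=
    fun hA hB hC => (contMDiffAt_mvfderiv_apply (contMDiffAt_inner hA hB) (hC.of_le one_le_two)
      (by norm_num [one_add_one_eq_two])).mdifferentiableAt one_ne_zero
  have diff_b : ∀ {A B C : Π x : M, TangentSpace I x}, CMDiffAt 2 (T% A) p → CMDiffAt 2 (T% B) p →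
      CMDiffAt 2 (T% C) p → MDiffAt (fun q => inner ℝ (mlieBracket I A B q) (C q)) p :=
    fun hA hB hC => mdifferentiableAt_inner
      ((contMDiffAt_mlieBracket hA hB).mdifferentiableAt one_ne_zero)
      (hC.mdifferentiableAt two_ne_zero)
  have near : ∀ {A : Π x : M, TangentSpace I x}, CMDiffAt 2 (T% A) p →
      ∀ᶠ q in 𝓝 p, MDiffAt (T% A) q := fun hA =>
    ((contMDiffAt_iff_contMDiffAt_nhds (by simp)).1 hA).mono
      fun q hq => hq.mdifferentiableAt two_ne_zero
  -- Tested against `Z`, the covariant derivative is half the Koszul expression, whose terms involve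
  -- only first derivatives of `C^2` data.
  refine mdifferentiableAt_of_inner fun Z hZ => ?_
  have hk : MDiffAt (fun q => (1 / 2 : ℝ) * koszul W V Z q) p := by
    refine mdifferentiableAt_const.mul ?_
    exact (((((diff_d hW hZ hV).add (diff_d hV hZ hW)).sub (diff_d hV hW hZ)).add
      (diff_b hV hW hZ)).sub (diff_b hV hZ hW)).sub (diff_b hW hZ hV)
  refine hk.congr_of_eventuallyEq ?_
  filter_upwards [near hV, near hW, near hZ] with q hVq hWq hZq
  rw [← two_inner_nabla hWq hVq hZq]
  simp [leviCivita]

/-! ### Symmetries of the curvature -/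

/-- Metric compatibility used twice. The two mixed terms are exchanged by swapping `U` and `V`, so
antisymmetrizing leaves only second covariant derivatives. -/
theorem mvfderiv_mvfderiv_inner {U V W Z : Π x : M, TangentSpace I x} {p : M}
    (hU : CMDiffAt 2 (T% U) p) (hV : CMDiffAt 2 (T% V) p)
    (hW : CMDiffAt 2 (T% W) p) (hZ : CMDiffAt 2 (T% Z) p) :
    d% (fun q => d% (fun r => inner ℝ (W r) (Z r)) q (V q)) p (U p) =
      inner ℝ (leviCivita (fun q => leviCivita W q (V q)) p (U p)) (Z p)
        + inner ℝ (leviCivita W p (V p)) (leviCivita Z p (U p))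
        + (inner ℝ (leviCivita W p (U p)) (leviCivita Z p (V p))
        + inner ℝ (W p) (leviCivita (fun q => leviCivita Z q (V q)) p (U p))) := by
  have near : ∀ {A : Π x : M, TangentSpace I x}, CMDiffAt 2 (T% A) p →
      ∀ᶠ q in 𝓝 p, MDiffAt (T% A) q := fun hA =>
    ((contMDiffAt_iff_contMDiffAt_nhds (by simp)).1 hA).mono
      fun q hq => hq.mdifferentiableAt two_ne_zero
  have h : (fun q => d% (fun r => inner ℝ (W r) (Z r)) q (V q)) =ᶠ[𝓝 p]
      (fun q => inner ℝ (leviCivita W q (V q)) (Z q))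
        + fun q => inner ℝ (W q) (leviCivita Z q (V q)) := by
    filter_upwards [near hV, near hW, near hZ] with q hVq hWq hZq
    exact leviCivita_metric hVq hWq hZq
  have hU1 := (near hU).self_of_nhds
  have hW1 := (near hW).self_of_nhds
  have hZ1 := (near hZ).self_of_nhds
  have hVW := mdifferentiableAt_leviCivita hV hW
  have hVZ := mdifferentiableAt_leviCivita hV hZ
  rw [mvfderiv_congr h, mvfderiv_add (mdifferentiableAt_inner hVW hZ1)
    (mdifferentiableAt_inner hW1 hVZ), _root_.add_apply,
    leviCivita_metric hU1 hVW hZ1, leviCivita_metric hU1 hW1 hVZ]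

/-- The curvature endomorphism `Rm(U, V)` is skew-adjoint. -/
theorem inner_curvatureField_swap {U V W Z : Π x : M, TangentSpace I x} {p : M}
    (hU : CMDiffAt 2 (T% U) p) (hV : CMDiffAt 2 (T% V) p)
    (hW : CMDiffAt 2 (T% W) p) (hZ : CMDiffAt 2 (T% Z) p) :
    inner ℝ (curvatureField U V W p) (Z p) = - inner ℝ (W p) (curvatureField U V Z p) := by
  have h := mvfderiv_mlieBracket hU hV (contMDiffAt_inner hW hZ)
  obtain ⟨B, hB, hBp⟩ := exists_extension (mlieBracket I U V p)
  have hm := leviCivita_metric hB (hW.mdifferentiableAt two_ne_zero)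
    (hZ.mdifferentiableAt two_ne_zero)
  rw [hBp] at hm
  rw [mvfderiv_mvfderiv_inner hU hV hW hZ, mvfderiv_mvfderiv_inner hV hU hW hZ, hm] at h
  simp only [curvatureField, inner_sub_left, inner_sub_right]
  linarith

/-- The curvature `Rm(U, V)W` at `p` depends on `W` only through its value at `p`. -/
theorem curvatureField_congr {U V W W' : Π x : M, TangentSpace I x} {p : M}
    (hU : CMDiffAt 2 (T% U) p) (hV : CMDiffAt 2 (T% V) p)
    (hW : CMDiffAt 2 (T% W) p) (hW' : CMDiffAt 2 (T% W') p) (h : W p = W' p) :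
    curvatureField U V W p = curvatureField U V W' p := by
  refine ext_inner_right ℝ fun w => ?_
  obtain ⟨Z, hZ, rfl⟩ : ∃ Z : Π x : M, TangentSpace I x, CMDiffAt 2 (T% Z) p ∧ Z p = w :=
    ⟨extend E w, contMDiffAt_extend I E w, by simp⟩
  -- After the swap the derivatives fall on `Z`, and only the value of `W` at `p` remains.
  rw [inner_curvatureField_swap hU hV hW hZ, inner_curvatureField_swap hU hV hW' hZ, h]

/-! ### Closed conformal vector fields -/

variable {X : Π x : M, TangentSpace I x} {ψ : M → ℝ} {p : M}

/-- If `∇_Y X = ψ Y` then `d|X|²(v) = 2 ψ ⟨X, v⟩`. -/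
theorem mvfderiv_inner_self_of_closed (hX : MDiffAt (T% X) p)
    (hc : leviCivita X p = ψ p • ContinuousLinearMap.id ℝ (TangentSpace I p))
    (v : TangentSpace I p) :
    d% (fun q => inner ℝ (X q) (X q)) p v = 2 * ψ p * inner ℝ (X p) v := by
  obtain ⟨V, hV, rfl⟩ := exists_extension v
  rw [leviCivita_metric hV hX hX, hc]
  simp [inner_smul_left, inner_smul_right, real_inner_comm]
  ring

theorem eventually_ne_zero (hX : CMDiff ∞ (T% X)) (hp : X p ≠ 0) : ∀ᶠ q in 𝓝 p, X q ≠ 0 := by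
  have hcont : ContinuousAt (fun q => (inner ℝ (X q) (X q) : ℝ)) p :=
    (contMDiffAt_inner (hX p) (hX p)).continuousAt
  filter_upwards [hcont.eventually_ne (inner_self_ne_zero.2 hp)] with q hq
  exact inner_self_ne_zero.1 hq

/-- The factor `ψ` in `∇_Y X = ψ Y` is smooth wherever `X` does not vanish. -/
theorem contMDiffAt_factor_of_closed (hX : CMDiff ∞ (T% X))
    (hc : ∀ q, leviCivita X q = ψ q • ContinuousLinearMap.id ℝ (TangentSpace I q))
    (hp : X p ≠ 0) : CMDiffAt 2 ψ p := by
  have hX3 : CMDiffAt 3 (T% X) p := (hX p).of_le ENat.LEInfty.out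
  have hX2 : CMDiffAt 2 (T% X) p := (hX p).of_le ENat.LEInfty.out
  have hi : CMDiffAt 2 (fun q => (inner ℝ (X q) (X q) : ℝ)) p := contMDiffAt_inner hX2 hX2
  have hd : CMDiffAt 2 (fun q => d% (fun r => inner ℝ (X r) (X r)) q (X q)) p :=
    contMDiffAt_mvfderiv_apply (contMDiffAt_inner hX3 hX3) hX2 (by norm_num)
  -- Here `ψ = X(|X|²) / (2|X|²)`, from `d|X|² = 2ψ⟨X, ·⟩` evaluated on `X`.
  refine (hd.div₀ (contMDiffAt_const.mul hi)
    (mul_ne_zero two_ne_zero (inner_self_ne_zero.2 hp))).congr_of_eventuallyEq ?_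
  filter_upwards [eventually_ne_zero hX hp] with q hq
  have h0 : (inner ℝ (X q) (X q) : ℝ) ≠ 0 := inner_self_ne_zero.2 hq
  simp only [Pi.div_apply, Pi.mul_apply]
  rw [mvfderiv_inner_self_of_closed ((hX q).mdifferentiableAt (by simp)) (hc q)]
  field_simp

/-- If `∇_Y X = ψ Y` then `Rm(U, V)X = dψ(U) V - dψ(V) U`. -/
theorem curvatureField_of_closed {U V : Π x : M, TangentSpace I x}
    (hc : ∀ q, leviCivita X q = ψ q • ContinuousLinearMap.id ℝ (TangentSpace I q))
    (hψ : MDiffAt ψ p) (hU : MDiffAt (T% U) p) (hV : MDiffAt (T% V) p) :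
    curvatureField U V X p = d% ψ p (U p) • V p - d% ψ p (V p) • U p := by
  have h : ∀ W : Π x : M, TangentSpace I x, (fun q => leviCivita X q (W q)) = ψ • W := by
    intro W; ext q; simp [hc]
  have hU' : leviCivita (ψ • U) p = ψ p • leviCivita U p + (d% ψ p).smulRight (U p) :=
    nabla_smul hU hψ
  have hV' : leviCivita (ψ • V) p = ψ p • leviCivita V p + (d% ψ p).smulRight (V p) :=
    nabla_smul hV hψ
  rw [curvatureField, h, h, hU', hV', hc, ← leviCivita_torsion hU hV]
  simp
  module

/-- If `∇_Y X = ψ Y` then `dψ` is proportional to `⟨X, ·⟩` wherever `X` does not vanish. -/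
theorem mvfderiv_factor_of_closed (hX : CMDiff ∞ (T% X))
    (hc : ∀ q, leviCivita X q = ψ q • ContinuousLinearMap.id ℝ (TangentSpace I q))
    (hp : X p ≠ 0) (v : TangentSpace I p) :
    d% ψ p v = d% ψ p (X p) / inner ℝ (X p) (X p) * inner ℝ (X p) v := by
  have hX2 : CMDiffAt 2 (T% X) p := (hX p).of_le ENat.LEInfty.out
  have hψ := (contMDiffAt_factor_of_closed hX hc hp).mdifferentiableAt two_ne_zero
  have hv : CMDiffAt 2 (T% (extend E v)) p := contMDiffAt_extend I E v
  -- Skew-adjointness gives `⟨Rm(v, X)X, X⟩ = 0`, that is, `dψ(v)|X|² = dψ(X)⟨X, v⟩`.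
  have h := inner_curvatureField_swap hv hX2 hX2 hX2
  rw [real_inner_comm] at h
  have h0 : (inner ℝ (X p) (curvatureField (extend E v) X X p) : ℝ) = 0 := by linarith
  rw [curvatureField_of_closed hc hψ (hv.mdifferentiableAt two_ne_zero)
    (hX2.mdifferentiableAt two_ne_zero)] at h0
  simp only [extend_apply_self, inner_sub_right, inner_smul_right] at h0
  have : (inner ℝ (X p) (X p) : ℝ) ≠ 0 := inner_self_ne_zero.2 hp
  field_simp
  linarith

/-- If `∇_Y X = ψ Y` and `φ = dψ(X) / |X|²` then `∇_v ∇ψ = φ ψ v + dφ(v) X` wherever `X` does not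
vanish. -/
theorem leviCivita_grad_factor_of_closed (hX : CMDiff ∞ (T% X))
    (hc : ∀ q, leviCivita X q = ψ q • ContinuousLinearMap.id ℝ (TangentSpace I q))
    (hp : X p ≠ 0) (v : TangentSpace I p) :
    leviCivita (grad I ψ) p v =
      (d% ψ p (X p) / inner ℝ (X p) (X p) * ψ p) • v
        + d% (fun q => d% ψ q (X q) / inner ℝ (X q) (X q)) p v • X p := by
  let φ : M → ℝ := fun q => d% ψ q (X q) / inner ℝ (X q) (X q)
  have hX1 : CMDiffAt 1 (T% X) p := (hX p).of_le ENat.LEInfty.out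
  have hφ : MDiffAt φ p :=
    ((contMDiffAt_mvfderiv_apply (contMDiffAt_factor_of_closed hX hc hp) hX1
      (by norm_num [one_add_one_eq_two])).div₀ (contMDiffAt_inner hX1 hX1)
      (inner_self_ne_zero.2 hp)).mdifferentiableAt one_ne_zero
  -- The identity `∇ψ = φX` is needed on a neighbourhood, since it is about to be differentiated.
  have hgrad : ∀ᶠ q in 𝓝 p, grad I ψ q = (φ • X) q := by
    filter_upwards [eventually_ne_zero hX hp] with q hq
    refine ext_inner_right ℝ fun w => ?_
    rw [grad, inner_sharp, mvfderiv_factor_of_closed hX hc hq]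
    simp [φ, inner_smul_left]
  have hφX : MDiffAt (T% (φ • X)) p := hφ.smul_section (hX1.mdifferentiableAt one_ne_zero)
  have hg : MDiffAt (T% (grad I ψ)) p := by
    refine hφX.congr_of_eventuallyEq ?_
    filter_upwards [hgrad] with q hq
    rw [hq]
  have h1 : leviCivita (grad I ψ) p = leviCivita (φ • X) p :=
    leviCivita.isCovariantDerivativeOnUniv.congr_of_eventuallyEq hg hφX Filter.univ_mem hgrad
  have h2 : leviCivita (φ • X) p = φ p • leviCivita X p + (d% φ p).smulRight (X p) :=
    nabla_smul (hX1.mdifferentiableAt one_ne_zero) hφ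
  rw [h1, h2, hc]
  simp [φ, smul_smul]

theorem hessian_factor_of_closed (hX : CMDiff ∞ (T% X))
    (hc : ∀ q, leviCivita X q = ψ q • ContinuousLinearMap.id ℝ (TangentSpace I q))
    (hp : X p ≠ 0) (v w : TangentSpace I p) :
    hessian ψ p v w =
      d% ψ p (X p) / inner ℝ (X p) (X p) * ψ p * inner ℝ v w
        + d% (fun q => d% ψ q (X q) / inner ℝ (X q) (X q)) p v * inner ℝ (X p) w := by
  rw [hessian, leviCivita_grad_factor_of_closed hX hc hp, inner_add_left, real_inner_smul_left,
    real_inner_smul_left]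

theorem laplacian_factor_of_closed (hX : CMDiff ∞ (T% X))
    (hc : ∀ q, leviCivita X q = ψ q • ContinuousLinearMap.id ℝ (TangentSpace I q))
    (hp : X p ≠ 0) :
    laplacian I ψ p =
      Module.finrank ℝ E * (d% ψ p (X p) / inner ℝ (X p) (X p) * ψ p)
        + d% (fun q => d% ψ q (X q) / inner ℝ (X q) (X q)) p (X p) := by
  let b := stdOrthonormalBasis ℝ (TangentSpace I p)
  have hn : Module.finrank ℝ (TangentSpace I p) = Module.finrank ℝ E := rfl
  -- The trace of `A ⊗ ⟨X, ·⟩` is `A(X)`; it is used for `A = dφ`.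
  have hsum : ∀ A : TangentSpace I p →L[ℝ] ℝ, ∑ i, A (b i) * inner ℝ (X p) (b i) = A (X p) := by
    intro A
    conv_rhs => rw [← b.sum_repr (X p)]
    simp [map_sum, b.repr_apply_apply, real_inner_comm, mul_comm]
  simp only [laplacian, hessian_factor_of_closed hX hc hp, Finset.sum_add_distrib]
  rw [hsum]
  simp [hn]

/-- If `∇_Y X = ψ Y` then `Rm(u, v)(cX) = c (dψ(u) v - dψ(v) u)` wherever `X` does not vanish. -/
theorem curvature_of_closed (hX : CMDiff ∞ (T% X))
    (hc : ∀ q, leviCivita X q = ψ q • ContinuousLinearMap.id ℝ (TangentSpace I q))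
    (hp : X p ≠ 0) (c : ℝ) (u v : TangentSpace I p) :
    curvature p u v (c • X p) = c • (d% ψ p u • v - d% ψ p v • u) := by
  have hX2 : CMDiffAt 2 (T% X) p := (hX p).of_le ENat.LEInfty.out
  have hψ := (contMDiffAt_factor_of_closed hX hc hp).mdifferentiableAt two_ne_zero
  have hs : ∀ w : TangentSpace I p, CMDiffAt 2 (T% (extend E w)) p := contMDiffAt_extend I E
  refine ext_inner_right ℝ fun w => ?_
  -- `curvature` uses the chosen extension of `c • X p`, while the closed-field formula concerns the
  -- field `X`. Skew-adjointness reduces both to `⟨X p, Rm(u, v)w⟩`, up to the factor `-c` or `-1`.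
  have h1 := inner_curvatureField_swap (hs u) (hs v) (hs (c • X p)) (hs w)
  have h2 := inner_curvatureField_swap (hs u) (hs v) hX2 (hs w)
  rw [curvatureField_of_closed hc hψ ((hs u).mdifferentiableAt two_ne_zero)
    ((hs v).mdifferentiableAt two_ne_zero)] at h2
  simp only [extend_apply_self, real_inner_smul_left] at h1 h2
  rw [curvature, h1, real_inner_smul_left, h2, mul_neg]

/-- If `∇_Y X = ψ Y` then `Ric(v, cX) = c (1 - n) dψ(v)` wherever `X` does not vanish. -/
theorem ricci_of_closed (hX : CMDiff ∞ (T% X))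
    (hc : ∀ q, leviCivita X q = ψ q • ContinuousLinearMap.id ℝ (TangentSpace I q))
    (hp : X p ≠ 0) (c : ℝ) (v : TangentSpace I p) :
    ricci p v (c • X p) = c * ((1 - Module.finrank ℝ E) * d% ψ p v) := by
  let b := stdOrthonormalBasis ℝ (TangentSpace I p)
  have hn : Module.finrank ℝ (TangentSpace I p) = Module.finrank ℝ E := rfl
  have hsum : ∑ i, d% ψ p (b i) * inner ℝ v (b i) = d% ψ p v := by
    conv_rhs => rw [← b.sum_repr v]
    simp [map_sum, b.repr_apply_apply, real_inner_comm, mul_comm]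
  simp only [ricci, curvature_of_closed hX hc hp, real_inner_smul_left, inner_sub_left,
    Finset.sum_sub_distrib, ← Finset.mul_sum]
  rw [hsum]
  simp [hn]
  -- Cancelling the common factor `c` leaves the alternative `c = 0`, which is not needed.
  left
  ring

end

end Riem

theorem theorem1p4 {n : ℕ} (hn : 2 ≤ n)
    {M : Type*} [TopologicalSpace M] [ChartedSpace (EuclideanSpace ℝ (Fin n)) M]
    [IsManifold (𝓡 n) ∞ M]
    [RiemannianBundle (fun x : M => TangentSpace (𝓡 n) x)]
    [IsContMDiffRiemannianBundle (𝓡 n) ∞ (EuclideanSpace ℝ (Fin n))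
      (fun x : M => TangentSpace (𝓡 n) x)]
    (X : Π x : M, TangentSpace (𝓡 n) x) (ρ R ψ : M → ℝ)
    (hR : R = Riem.scalarCurvature (𝓡 n)) (hψ : ψ = Riem.conformalFactor (𝓡 n) ρ)
    (hsol : Riem.IsAlmostYamabeSoliton X ρ) (hclosed : Riem.IsClosedField X ρ) :
    Riem.IsKilling X ∨
      ∀ (p : M) (e : TangentSpace (𝓡 n) p), X p ≠ 0 → e = ‖X p‖⁻¹ • X p →
        Riem.hessian ψ p e e + R p * ψ p / (n - 1) * inner ℝ e e - ψ p * Riem.ricci p e e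
          = Riem.laplacian (𝓡 n) ψ p + R p * ψ p / (n - 1) := by
  right
  rintro p e hp rfl
  have hX := hsol.smooth_field
  have hc : ∀ q, Riem.leviCivita X q = ψ q • ContinuousLinearMap.id ℝ (TangentSpace (𝓡 n) q) := by
    intro q
    ext1 v
    rw [hclosed q v, hψ]
    rfl
  have hN : ‖X p‖ ≠ 0 := norm_ne_zero_iff.2 hp
  have he : ‖‖X p‖⁻¹ • X p‖ = 1 := by rw [norm_smul, norm_inv, norm_norm, inv_mul_cancel₀ hN]
  -- With `c = |X|⁻¹`, the claim becomes `φψ + dφ(X) - (1 - n)φψ = nφψ + dφ(X)`, with the same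
  -- scalar curvature term on both sides.
  rw [Riem.hessian_factor_of_closed hX hc hp, Riem.laplacian_factor_of_closed hX hc hp,
    Riem.ricci_of_closed hX hc hp]
  simp only [real_inner_smul_right, map_smul, smul_eq_mul,
    real_inner_self_eq_norm_sq, he, finrank_euclideanSpace, Fintype.card_fin]
  field_simp
  ring
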